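/- Let $[\mathbb{N}]^2$ be the set of two-element subsets of $\mathbb{N}$, and let $c:[\mathbb{N}]^2\to\{0,1\}$ be a $2$-coloring. A path of color $k$ is a finite (possibly empty) or infinite list $a_0,a_1,a_2,\dots$ of distinct natural numbers such that $c(\{a_{i-1},a_i\})=k$ for all $i\ge 1$ for which $a_i$ is defined; it is regarded as the partial function $i\mapsto a_i$ on $\mathbb{N}$, whose domain is an initial segment of $\mathbb{N}$. A path decomposition for $c$ is a pair $(P_0,P_1)$ such that $P_j$ is a path of color $j$ for $j=0,1$ and every natural number appears on exactly one of $P_0,P_1$. It is $\Delta^0_2$ in $c$ if $P_0$ and $P_1$ are both partial functions computable from the Turing jump $c'$ of $c$. Theorem. Every $2$-coloring $c$ of $[\mathbb{N}]^2$ has a path decomposition that is $\Delta^0_2$ in $c$. In particular, every computable $2$-coloring $c$ of $[\mathbb{N}]^2$ has a path decomposition $(P_0,P_1)$ such that $P_0$ and $P_1$ are both computable from the halting set $K$. -/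

import Mathlib

namespace RadoPath

/-! ### Colorings and path decompositions -/

/-- An `r`-coloring of `[ℕ]²`, the set of unordered pairs of distinct natural numbers. -/
abbrev Coloring (r : ℕ) : Type := {e : Sym2 ℕ // ¬ e.IsDiag} → Fin r

/-- The color `c({x, y})` of the pair formed by two distinct numbers `x` and `y`. -/
def Coloring.color {r : ℕ} (c : Coloring r) (x y : ℕ) (h : x ≠ y) : Fin r :=
  c ⟨s(x, y), by simpa using h⟩

/-- A (monochromatic) path of color `k`: a finite or infinite list `P 0, P 1, …` of distinct
numbers whose consecutive members form pairs of color `k`. A list is a partial function on `ℕ`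
whose domain is an initial segment; the empty list and the lists of length one are paths of every
color. -/
structure IsPath {r : ℕ} (c : Coloring r) (k : Fin r) (P : ℕ →. ℕ) : Prop where
  dom_initial : ∀ m n : ℕ, m ≤ n → (P n).Dom → (P m).Dom
  distinct : ∀ m n x : ℕ, x ∈ P m → x ∈ P n → m = n
  color_eq : ∀ n x y : ℕ, x ∈ P n → y ∈ P (n + 1) → ∃ h : x ≠ y, c.color x y h = k

/-- A path decomposition: `r` paths, the `j`-th one of color `j`, such that every number appears
on exactly one of them. -/
structure IsPathDecomposition {r : ℕ} (c : Coloring r) (P : Fin r → ℕ →. ℕ) : Prop where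
  isPath : ∀ j : Fin r, IsPath c j (P j)
  partition : ∀ x : ℕ, ∃! j : Fin r, ∃ n : ℕ, x ∈ P j n

/-! ### Oracle programs, the Turing jump and the halting set -/

/-- Programs for the partial functions that are recursive in one oracle. -/
inductive OCode : Type
  | zero : OCode
  | succ : OCode
  | left : OCode
  | right : OCode
  | oracle : OCode
  | pair : OCode → OCode → OCode
  | comp : OCode → OCode → OCode
  | prec : OCode → OCode → OCode
  | rfind : OCode → OCode

namespace OCode

/-- The partial function computed by a program from the oracle `g`. -/
def eval (g : ℕ →. ℕ) : OCode → ℕ →. ℕ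
  | zero => fun _ => Part.some 0
  | succ => fun n => Part.some (n + 1)
  | left => fun n => Part.some n.unpair.1
  | right => fun n => Part.some n.unpair.2
  | oracle => g
  | pair p q => fun n => Nat.pair <$> eval g p n <*> eval g q n
  | comp p q => fun n => eval g q n >>= eval g p
  | prec p q => fun n =>
      n.unpair.2.rec (eval g p n.unpair.1) fun y IH => do
        let i ← IH
        eval g q (Nat.pair n.unpair.1 (Nat.pair y i))
  | rfind p => fun a => Nat.rfind fun n => (fun m => m = 0) <$> eval g p (Nat.pair a n)

/-- The Gödel number of a program. -/
def index : OCode → ℕ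
  | zero => 0
  | succ => 1
  | left => 2
  | right => 3
  | oracle => 4
  | pair p q => 4 * Nat.pair p.index q.index + 5
  | comp p q => 4 * Nat.pair p.index q.index + 6
  | prec p q => 4 * Nat.pair p.index q.index + 7
  | rfind p => 4 * p.index + 8

/-- Different programs have different Gödel numbers. -/
theorem index_injective : Function.Injective index := by
  intro p
  induction p with
  | zero | succ | left | right | oracle => intro q h; cases q <;> simp [index] at h ⊢
  | pair p₁ p₂ h₁ h₂ | comp p₁ p₂ h₁ h₂ | prec p₁ p₂ h₁ h₂ =>
    intro q h
    cases q <;> simp only [index] at h <;> try omega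
    rename_i q₁ q₂
    have h' := Nat.pair_eq_pair.1 (show Nat.pair p₁.index p₂.index = Nat.pair q₁.index q₂.index by
      omega)
    rw [h₁ h'.1, h₂ h'.2]
  | rfind p₁ h₁ =>
    intro q h
    cases q <;> simp only [index] at h <;> try omega
    rename_i q₁
    rw [h₁ (show p₁.index = q₁.index by omega)]

/-- Every number is the Gödel number of a program. -/
theorem index_surjective : Function.Surjective index := by
  intro e
  induction e using Nat.strong_induction_on with
  | _ e ih =>
    by_cases he : e < 5
    · interval_cases e
      exacts [⟨zero, rfl⟩, ⟨succ, rfl⟩, ⟨left, rfl⟩, ⟨right, rfl⟩, ⟨oracle, rfl⟩]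
    · have hl := Nat.unpair_left_le ((e - 5) / 4)
      have hr := Nat.unpair_right_le ((e - 5) / 4)
      obtain ⟨p, hp⟩ := ih ((e - 5) / 4).unpair.1 (by omega)
      obtain ⟨q, hq⟩ := ih ((e - 5) / 4).unpair.2 (by omega)
      obtain ⟨t, ht⟩ := ih ((e - 5) / 4) (by omega)
      have hpq : Nat.pair p.index q.index = (e - 5) / 4 := by rw [hp, hq, Nat.pair_unpair]
      have hcases : (e - 5) % 4 = 0 ∨ (e - 5) % 4 = 1 ∨ (e - 5) % 4 = 2 ∨ (e - 5) % 4 = 3 := by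
        omega
      rcases hcases with h | h | h | h
      · exact ⟨pair p q, by simp only [index, hpq]; omega⟩
      · exact ⟨comp p q, by simp only [index, hpq]; omega⟩
      · exact ⟨prec p q, by simp only [index, hpq]; omega⟩
      · exact ⟨rfind t, by simp only [index, ht]; omega⟩

/-- The programs compute exactly the partial functions recursive in the oracle. -/
theorem recursiveIn_iff_exists_eval (g f : ℕ →. ℕ) :
    Nat.RecursiveIn {g} f ↔ ∃ p : OCode, p.eval g = f := by
  constructor
  · intro hf
    induction hf with
    | zero => exact ⟨zero, rfl⟩
    | succ => exact ⟨succ, rfl⟩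
    | left => exact ⟨left, rfl⟩
    | right => exact ⟨right, rfl⟩
    | oracle g' hg => rw [Set.mem_singleton_iff.1 hg]; exact ⟨oracle, rfl⟩
    | pair _ _ h₁ h₂ =>
      obtain ⟨p, rfl⟩ := h₁; obtain ⟨q, rfl⟩ := h₂; exact ⟨pair p q, rfl⟩
    | comp _ _ h₁ h₂ =>
      obtain ⟨p, rfl⟩ := h₁; obtain ⟨q, rfl⟩ := h₂; exact ⟨comp p q, rfl⟩
    | prec _ _ h₁ h₂ =>
      obtain ⟨p, rfl⟩ := h₁; obtain ⟨q, rfl⟩ := h₂; exact ⟨prec p q, rfl⟩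
    | rfind _ h₁ => obtain ⟨p, rfl⟩ := h₁; exact ⟨rfind p, rfl⟩
  · rintro ⟨p, rfl⟩
    induction p with
    | zero => exact Nat.RecursiveIn.zero
    | succ => exact Nat.RecursiveIn.succ
    | left => exact Nat.RecursiveIn.left
    | right => exact Nat.RecursiveIn.right
    | oracle => exact Nat.RecursiveIn.oracle g rfl
    | pair _ _ h₁ h₂ => exact Nat.RecursiveIn.pair h₁ h₂
    | comp _ _ h₁ h₂ => exact Nat.RecursiveIn.comp h₁ h₂
    | prec _ _ h₁ h₂ => exact Nat.RecursiveIn.prec h₁ h₂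
    | rfind _ h₁ => exact Nat.RecursiveIn.rfind h₁

end OCode

/-- The Turing jump of `g`: the set of all `e` such that the program with Gödel number `e` and
oracle `g` halts on input `e`. -/
def jump (g : ℕ → ℕ) : Set ℕ :=
  {e | ∃ p : OCode, p.index = e ∧ (p.eval (fun n => Part.some (g n)) e).Dom}

/-- The halting set `K`: the set of all `e` such that the program (without oracle) with Gödel
number `e` halts on input `e`. -/
def haltingSet : Set ℕ :=
  {e | ((Nat.Partrec.Code.ofNatCode e).eval e).Dom}

open Classical in
/-- A partial function is computable from a set `A` if it is recursive in the characteristic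
function of `A`. -/
def ComputableFrom (A : Set ℕ) (f : ℕ →. ℕ) : Prop :=
  Nat.RecursiveIn {fun n => Part.some (if n ∈ A then 1 else 0)} f

/-- A coloring as a function on `ℕ`: the code of the ordered pair `(x, y)` with `x ≠ y` goes to
`c({x, y})`, the code of `(x, x)` goes to `0`. -/
def Coloring.toFun {r : ℕ} (c : Coloring r) (n : ℕ) : ℕ :=
  if h : n.unpair.1 ≠ n.unpair.2 then (c.color n.unpair.1 n.unpair.2 h : ℕ) else 0

/-- A coloring is computable if it is so as a function on `ℕ`. -/
def Coloring.IsComputable {r : ℕ} (c : Coloring r) : Prop :=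
  Computable c.toFun

/-- A family of paths is `Δ⁰₂` in `c` if all of its members are partial functions computable from
the jump `c'`. -/
def IsDelta2In {r : ℕ} (c : Coloring r) (P : Fin r → ℕ →. ℕ) : Prop :=
  ∀ j : Fin r, ComputableFrom (jump c.toFun) (P j)

end RadoPath

/-! ### Computability: deciding co-enumerable predicates and running searches -/

namespace RadoPath

open Encodable

/-! ### Total functions and oracles -/

/-! Two finite disjoint chains, one of each color, are grown in stages; stage `k` puts the number
`k` on one of them. The growth must never get stuck, and a non-uniform case split on the sets
`eventual c j` secures this.

If `eventual c j` is infinite for some `j`, with `i` the other color, states carry a bound from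
which on every number continues both chains. A new `x` with eventual color `i` goes to the end of
the `i`-chain after a large number. Otherwise `x` has infinitely many `j`-neighbors and joins the
`j`-chain, which is then closed off by an element of `eventual c j`
(`exists_chain_extension_of_infinite`).

If both sets are finite, they are first absorbed into initial chains of their own colors
(`exists_chain_superset`). Afterwards the end of each chain always has infinitely many neighbors in
the color of the chain, and a triangle argument inserts any `x` (`exists_chain_extension`).

"`t` is a good extension of `s` covering `k`" is co-enumerable in `c`, hence decidable from `c'`, or
from `K` if `c` is computable. `DecidesDomains` captures what both oracles provide. A search for
successive states then computes both paths as limits of growing lists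
(`exists_decomposition_of_transitions`). -/

theorem recursiveIn_comp {O : Set (ℕ →. ℕ)} {f g : ℕ → ℕ}
    (hf : Nat.RecursiveIn O fun n => Part.some (f n))
    (hg : Nat.RecursiveIn O fun n => Part.some (g n)) :
    Nat.RecursiveIn O fun n => Part.some (f (g n)) :=
  (hf.comp hg).of_eq fun n => by simp [Part.bind_eq_bind]

theorem recursiveIn_pair {O : Set (ℕ →. ℕ)} {f g : ℕ → ℕ}
    (hf : Nat.RecursiveIn O fun n => Part.some (f n))
    (hg : Nat.RecursiveIn O fun n => Part.some (g n)) :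
    Nat.RecursiveIn O fun n => Part.some (Nat.pair (f n) (g n)) :=
  (hf.pair hg).of_eq fun n => by simp [Seq.seq]

theorem recursiveIn_of_primrec {O : Set (ℕ →. ℕ)} {f : ℕ → ℕ} (hf : Primrec f) :
    Nat.RecursiveIn O fun n => Part.some (f n) :=
  Nat.Primrec.recursiveIn (Primrec.nat_iff.1 hf)

theorem recursiveIn_rfind {O : Set (ℕ →. ℕ)} {f : ℕ → ℕ}
    (hf : Nat.RecursiveIn O fun n => Part.some (f n)) :
    Nat.RecursiveIn O fun a => Nat.rfind fun n => Part.some (decide (f (Nat.pair a n) = 0)) :=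
  hf.rfind.of_eq fun n => by simp

/-! ### Oracles that decide domains -/

open Classical in
/-- The oracles `O` decide the domain of every partial function recursive in `f`. -/
def DecidesDomains (O : Set (ℕ →. ℕ)) (f : ℕ → ℕ) : Prop :=
  ∀ h : ℕ →. ℕ, Nat.RecursiveIn {fun n => Part.some (f n)} h →
    Nat.RecursiveIn O fun n => Part.some (if (h n).Dom then 1 else 0)

namespace OCode

/-- A program for the constant function with value `n`. -/
def const : ℕ → OCode
  | 0 => zero
  | n + 1 => comp succ (const n)

theorem eval_const (g : ℕ →. ℕ) (n m : ℕ) : (const n).eval g m = Part.some n := by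
  induction n with
  | zero => rfl
  | succ n ih => simp [const, eval, ih]

theorem eval_comp_const (g : ℕ →. ℕ) (p : OCode) (n m : ℕ) :
    (comp p (const n)).eval g m = p.eval g n := by
  change Part.bind ((const n).eval g m) (p.eval g) = _
  rw [eval_const]
  exact Part.bind_some n fun m => p.eval g m

theorem primrec_index_const : Primrec fun n => (const n).index := by
  have : Primrec fun n : ℕ =>
      (Nat.rec 0 (fun _ i => 4 * Nat.pair 1 i + 6) n : ℕ) := by
    refine Primrec.nat_rec₁ _ ?_
    exact Primrec.nat_add.comp (Primrec.nat_mul.comp (Primrec.const 4)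
      (Primrec₂.natPair.comp (Primrec.const 1) Primrec.snd)) (Primrec.const 6)
  refine this.of_eq fun n => ?_
  induction n with
  | zero => rfl
  | succ n ih => simp only [const, index, ← ih]

end OCode

/-- The program that ignores its input and runs `p` on `n` halts on its own index iff `p` halts on
`n`, and its index is primitive recursive in `n`. -/
theorem decidesDomains_jump (g : ℕ → ℕ) :
    DecidesDomains {open Classical in fun n => Part.some (if n ∈ jump g then 1 else 0)} g := by
  classical
  intro h hh
  obtain ⟨p, rfl⟩ := (OCode.recursiveIn_iff_exists_eval _ _).1 hh
  have hf : Primrec fun n => (OCode.comp p (OCode.const n)).index :=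
    Primrec.nat_add.comp (Primrec.nat_mul.comp (Primrec.const 4)
      (Primrec₂.natPair.comp (Primrec.const _) OCode.primrec_index_const)) (Primrec.const 6)
  refine ((Nat.RecursiveIn.oracle _ (Set.mem_singleton _)).comp
    (recursiveIn_of_primrec hf)).of_eq fun n => ?_
  have key : (OCode.comp p (OCode.const n)).index ∈ jump g ↔
      (p.eval (fun n => Part.some (g n)) n).Dom := by
    constructor
    · rintro ⟨q, hq, hd⟩
      rw [OCode.index_injective hq] at hd
      exact (congrArg Part.Dom (OCode.eval_comp_const _ p n _)).mp hd
    · intro hd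
      exact ⟨_, rfl, (congrArg Part.Dom (OCode.eval_comp_const _ p n _)).mpr hd⟩
  simp [key]

/-- A computable oracle can be eliminated; after that the argument is the one for the jump, with
oracle-free programs. -/
theorem decidesDomains_haltingSet {g : ℕ → ℕ} (hg : Computable g) :
    DecidesDomains {open Classical in fun n => Part.some (if n ∈ haltingSet then 1 else 0)} g := by
  classical
  intro h hh
  have hp : Nat.Partrec h := hh.partrec_of_oracle (by
    rintro _ rfl
    exact Partrec.nat_iff.1 hg)
  obtain ⟨p, rfl⟩ := Nat.Partrec.Code.exists_code.1 hp
  have hf : Primrec fun n => encode (p.comp (Nat.Partrec.Code.const n)) :=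
    Primrec.encode.comp (Nat.Partrec.Code.primrec₂_comp.comp (Primrec.const _)
      Nat.Partrec.Code.primrec_const)
  refine ((Nat.RecursiveIn.oracle _ (Set.mem_singleton _)).comp
    (recursiveIn_of_primrec hf)).of_eq fun n => ?_
  have key : encode (p.comp (Nat.Partrec.Code.const n)) ∈ haltingSet ↔ (p.eval n).Dom := by
    have : Nat.Partrec.Code.ofNatCode (encode (p.comp (Nat.Partrec.Code.const n))) =
        p.comp (Nat.Partrec.Code.const n) := Denumerable.ofNat_encode (α := Nat.Partrec.Code) _
    have he : ∀ m, (p.comp (Nat.Partrec.Code.const n)).eval m = p.eval n := fun m => by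
      change Part.bind ((Nat.Partrec.Code.const n).eval m) p.eval = _
      rw [Nat.Partrec.Code.eval_const]
      exact Part.bind_some n fun m => p.eval m
    simp [haltingSet, this, he]
  simp [key]

/-! ### Predicates that are co-enumerable in a function -/

open Classical in
/-- A set of codes that is co-enumerable in `f` is decidable in all oracles that decide the domains
of the partial functions recursive in `f`. -/
theorem DecidesDomains.recursiveIn_forall {O : Set (ℕ →. ℕ)} {f : ℕ → ℕ} (hO : DecidesDomains O f)
    {α β : Type*} [Primcodable α] [Primcodable β] {q : α × β → ℕ} (hq : Primrec q)
    {B : (α × β) × ℕ → Prop} (hB : PrimrecPred B) :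
    Nat.RecursiveIn O fun n => Part.some
      (if ∀ a ∈ (decode n : Option α), ∀ b : β, B ((a, b), f (q (a, b))) then 0 else 1) := by
  have hq' : Primrec fun m : ℕ =>
      (decode (α := α × β) m).elim 0 q := by
    refine (Primrec.option_casesOn Primrec.decode (Primrec.const 0) (hq.comp₂ Primrec₂.right)).of_eq
      fun n => ?_
    cases decode (α := α × β) n <;> rfl
  -- The value 0 signals a counterexample to `B`. A number coding no pair gets 1, so it never stops
  -- the search.
  have hB' : Primrec fun m : ℕ => (decode (α := α × β) m.unpair.1).elim 1
      fun p => bif decide (B (p, m.unpair.2)) then 1 else 0 := by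
    refine (Primrec.option_casesOn (Primrec.decode.comp (Primrec.fst.comp Primrec.unpair))
      (Primrec.const 1) (g := fun (m : ℕ) p => bif decide (B (p, m.unpair.2)) then 1 else 0)
        ?_).of_eq fun m => ?_
    · refine Primrec.cond ?_ (Primrec.const 1) (Primrec.const 0)
      exact hB.decide.comp (Primrec.pair Primrec.snd
        (Primrec.snd.comp (Primrec.unpair.comp Primrec.fst)))
    · cases decode (α := α × β) m.unpair.1 <;> rfl
  -- This search for a code of a bad `b` halts exactly if the universal statement fails, so deciding
  -- its domain decides the statement.
  have hs := recursiveIn_rfind (recursiveIn_comp (recursiveIn_of_primrec hB')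
    (recursiveIn_pair (recursiveIn_of_primrec Primrec.id) (recursiveIn_comp
      (Nat.RecursiveIn.oracle _ (Set.mem_singleton fun n => Part.some (f n)))
        (recursiveIn_of_primrec hq'))))
  refine (hO _ hs).of_eq fun n => ?_
  have hdom : (∃ v : ℕ, (decode (α := α × β) (Nat.pair n v)).elim 1
        (fun p => bif decide (B (p, f ((decode (α := α × β) (Nat.pair n v)).elim 0 q)))
          then 1 else 0) = 0) ↔
      ¬ ∀ a ∈ (decode n : Option α), ∀ b : β, B ((a, b), f (q (a, b))) := by
    push Not
    constructor
    · rintro ⟨v, hv⟩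
      rcases ha : (decode n : Option α) with _ | a
      · simp [Encodable.decode_prod_val, ha] at hv
      rcases hb : (decode v : Option β) with _ | b
      · simp [Encodable.decode_prod_val, ha, hb] at hv
      refine ⟨a, rfl, b, ?_⟩
      intro hB
      simp [Encodable.decode_prod_val, ha, hb, hB] at hv
    · rintro ⟨a, ha, b, hb⟩
      refine ⟨encode b, ?_⟩
      rw [Option.mem_def] at ha
      simp [Encodable.decode_prod_val, ha, hb]
  congr 1
  have hd : (Nat.rfind fun v => Part.some (decide ((decode (α := α × β) (Nat.pair n v)).elim 1
        (fun p => bif decide (B (p, f ((decode (α := α × β) (Nat.pair n v)).elim 0 q)))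
          then 1 else 0) = 0))).Dom ↔
      ¬ ∀ a ∈ (decode n : Option α), ∀ b : β, B ((a, b), f (q (a, b))) := by
    rw [← hdom]
    refine (Nat.rfind_dom (p := fun v => Part.some _)).trans ?_
    simp
  simp only [Nat.unpair_pair, id]
  by_cases h : ∀ a ∈ (decode n : Option α), ∀ b : β, B ((a, b), f (q (a, b)))
  · rw [if_pos h, if_neg (fun h' => hd.1 h' h)]
  · rw [if_neg h, if_pos (hd.2 h)]

/-! ### Iterated searches -/

open Classical in
/-- If every state `s` with `I s` has at every stage `k` a successor `t` with `Q k s t`, then there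
is an infinite run, recursive in every set of oracles that decides `Q`. -/
theorem exists_recursiveIn_run {O : Set (ℕ →. ℕ)} {Q : ℕ → ℕ → ℕ → Prop}
    (hQ : Nat.RecursiveIn O fun n => Part.some
      (if Q n.unpair.1.unpair.1 n.unpair.1.unpair.2 n.unpair.2 then 0 else 1))
    {I : ℕ → Prop} {s₀ : ℕ} (h₀ : I s₀) (hex : ∀ k s, I s → ∃ t, Q k s t)
    (hI : ∀ k s t, I s → Q k s t → I t) :
    ∃ S : ℕ → ℕ, S 0 = s₀ ∧ (∀ k, I (S k)) ∧ (∀ k, Q k (S k) (S (k + 1))) ∧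
      Nat.RecursiveIn O fun k => Part.some (S k) := by
  -- The least successor is what an unbounded search returns; the default 0 is never reached from
  -- states satisfying `I`.
  let next : ℕ → ℕ → ℕ := fun k s => if h : ∃ t, Q k s t then Nat.find h else 0
  let S : ℕ → ℕ := fun k => Nat.rec s₀ next k
  have hS : ∀ k, I (S k) := by
    intro k
    induction k with
    | zero => exact h₀
    | succ k ih =>
      have h := hex k _ ih
      have : S (k + 1) = Nat.find h := dif_pos h
      rw [this]
      exact hI k _ _ ih (Nat.find_spec h)
  have hstep : ∀ k, S (k + 1) = Nat.find (hex k _ (hS k)) := fun k => dif_pos _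
  refine ⟨S, rfl, hS, fun k => ?_, ?_⟩
  · rw [hstep]
    exact Nat.find_spec (hex k _ (hS k))
  · have hp : Nat.RecursiveIn O _ := .prec (recursiveIn_of_primrec (Primrec.const s₀))
      ((recursiveIn_rfind hQ).comp (recursiveIn_of_primrec (Primrec.snd.comp Primrec.unpair)))
    refine (hp.comp (recursiveIn_of_primrec
      (Primrec₂.natPair.comp (Primrec.const 0) Primrec.id))).of_eq fun k => ?_
    simp only [Part.bind_eq_bind, Part.bind_some, Nat.unpair_pair, id]
    induction k with
    | zero => rfl
    | succ k ih =>
      refine (congrArg (fun z => Part.bind z _) ih).trans ?_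
      simp only [Part.bind_some]
      rw [hstep]
      refine Part.eq_some_iff.2 (Nat.mem_rfind.2 ⟨?_, ?_⟩)
      · simpa using Nat.find_spec (hex k _ (hS k))
      · intro m hm
        simpa using Nat.find_min (hex k _ (hS k)) hm

/-- The partial function reading entry `i` at the first stage of a run at which it is present. -/
theorem recursiveIn_read {O : Set (ℕ →. ℕ)} {S : ℕ → ℕ}
    (hS : Nat.RecursiveIn O fun k => Part.some (S k)) {L : ℕ → List ℕ} (hL : Primrec L) :
    Nat.RecursiveIn O fun i =>
      (Nat.rfind fun k => Part.some (decide (i < (L (S k)).length))).map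
        fun k => (L (S k)).getD i 0 := by
  have h1 : Primrec fun n : ℕ => if n.unpair.1 < (L n.unpair.2).length then 0 else 1 := by
    refine Primrec.ite (Primrec.nat_lt.comp (Primrec.fst.comp Primrec.unpair)
      (Primrec.list_length.comp (hL.comp (Primrec.snd.comp Primrec.unpair))))
      (Primrec.const 0) (Primrec.const 1)
  have h2 : Primrec fun n : ℕ => (L n.unpair.2).getD n.unpair.1 0 :=
    (Primrec.list_getD 0).comp (hL.comp (Primrec.snd.comp Primrec.unpair))
      (Primrec.fst.comp Primrec.unpair)
  have hfst : Primrec fun n : ℕ => n.unpair.1 := Primrec.fst.comp Primrec.unpair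
  have hsnd : Primrec fun n : ℕ => n.unpair.2 := Primrec.snd.comp Primrec.unpair
  have hq : Nat.RecursiveIn O fun n => Part.some (Nat.pair n.unpair.1 (S n.unpair.2)) :=
    recursiveIn_pair (recursiveIn_of_primrec hfst)
      (recursiveIn_comp hS (recursiveIn_of_primrec hsnd))
  have hr := recursiveIn_rfind (recursiveIn_comp (recursiveIn_of_primrec h1) hq)
  refine ((recursiveIn_comp (recursiveIn_of_primrec h2) hq).comp
    (.pair (recursiveIn_of_primrec Primrec.id) hr)).of_eq fun i => ?_
  simp [Seq.seq, Part.bind_eq_bind, Part.map_eq_map, Part.bind_some_eq_map]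
  rw [Part.map_map]
  simp [Function.comp_def]

end RadoPath
-- Combinatorics: extending pairs of finite chains
namespace RadoPath

/-! ### Chains of one color -/

/-- The numbers `x` and `y` are different and form a pair of color `j`. -/
def Joined {r : ℕ} (c : Coloring r) (j : Fin r) (x y : ℕ) : Prop :=
  ∃ h : x ≠ y, c.color x y h = j

/-- The numbers that form pairs of color `j` with almost all numbers. -/
def eventual {r : ℕ} (c : Coloring r) (j : Fin r) : Set ℕ :=
  {x | ∃ m, ∀ v ≥ m, v ≠ x → Joined c j x v}

variable {c : Coloring 2} {i j : Fin 2}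

theorem Joined.symm {r : ℕ} {c : Coloring r} {j : Fin r} {x y : ℕ} (h : Joined c j x y) :
    Joined c j y x := by
  obtain ⟨h, hc⟩ := h
  refine ⟨h.symm, ?_⟩
  rw [← hc]
  simp only [Coloring.color, Sym2.eq_swap]

theorem joined_or (hij : i ≠ j) {x y : ℕ} (h : x ≠ y) : Joined c i x y ∨ Joined c j x y := by
  have : c.color x y h = i ∨ c.color x y h = j := by omega
  exact this.imp (fun e => ⟨h, e⟩) fun e => ⟨h, e⟩

theorem Joined.not_joined (hij : i ≠ j) {x y : ℕ} (h : Joined c i x y) : ¬ Joined c j x y := by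
  rintro ⟨_, h'⟩
  exact hij (h.2.symm.trans h')

theorem not_mem_eventual_of_ne (hij : i ≠ j) {x : ℕ} (h : x ∈ eventual c i) :
    x ∉ eventual c j := by
  rintro ⟨m, hm⟩
  obtain ⟨m', hm'⟩ := h
  have h1 : max (max m m') (x + 1) ≥ m := by omega
  have h2 : max (max m m') (x + 1) ≥ m' := by omega
  have h3 : max (max m m') (x + 1) ≠ x := by omega
  exact (hm' _ h2 h3).not_joined hij (hm _ h1 h3)

theorem exists_joined_of_not_mem_eventual (hij : i ≠ j) {x : ℕ} (h : x ∉ eventual c i) (N : ℕ) :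
    ∃ u ≥ N, Joined c j x u := by
  by_contra! hN
  exact h ⟨N, fun v hv hvx => (joined_or hij hvx.symm).resolve_right (hN v hv)⟩

theorem exists_bound (l : List ℕ) : ∃ M, ∀ x ∈ l, x < M :=
  ⟨l.sum + 1, fun _ hx => Nat.lt_succ_of_le (List.le_sum_of_mem hx)⟩

/-- The chain `l` of color `j` can be continued by arbitrarily large numbers. -/
def Extendable {r : ℕ} (c : Coloring r) (j : Fin r) (l : List ℕ) : Prop :=
  ∀ N, ∃ u ≥ N, (l ++ [u]).IsChain (Joined c j)

/-- With two colors, a last element without eventual color `i` has arbitrarily large `j`-neighbors;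
the empty chain can be continued by anything. -/
theorem extendable_of_getLast (hij : i ≠ j) {l : List ℕ} (hl : l.IsChain (Joined c j))
    (h : ∀ x ∈ l.getLast?, x ∉ eventual c i) : Extendable c j l := by
  intro N
  rcases hx : l.getLast? with _ | x
  · exact ⟨N, le_rfl, List.isChain_append.2 ⟨hl, by simp, by simp [hx]⟩⟩
  · obtain ⟨u, hu, hxu⟩ := exists_joined_of_not_mem_eventual hij (h x hx) N
    exact ⟨u, hu, List.isChain_append.2 ⟨hl, by simp, by simpa [hx] using hxu⟩⟩

/-- A finite set of numbers with eventual color `j` lies on a chain of color `j` that can be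
continued, and that avoids a given finite set. -/
theorem exists_chain_superset (hij : i ≠ j) {F : Set ℕ} (hF : F.Finite)
    (hFj : F ⊆ eventual c j) (G : List ℕ) (hG : ∀ x ∈ F, x ∉ G) :
    ∃ l : List ℕ, l.IsChain (Joined c j) ∧ l.Nodup ∧ (∀ x ∈ l, x ∉ G) ∧ (∀ x ∈ F, x ∈ l) ∧
      ∀ x ∈ l.getLast?, x ∈ eventual c j := by
  induction F, hF using Set.Finite.induction_on with
  | empty => exact ⟨[], by simp⟩
  | @insert x F _ _ ih =>
    obtain ⟨l, hc, hn, hlG, hFl, hlast⟩ := ih (fun y hy => hFj (Or.inr hy))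
      fun y hy => hG y (Or.inr hy)
    by_cases hxl : x ∈ l
    · exact ⟨l, hc, hn, hlG, by rintro y (rfl | hy); exacts [hxl, hFl y hy], hlast⟩
    obtain ⟨m, hm⟩ := hFj (Set.mem_insert x F)
    obtain ⟨M, hM⟩ := exists_bound (x :: (l ++ G))
    -- `u` is a bridge from the end of `l` to `x`: being at least `m`, it is a `j`-neighbor of `x`.
    obtain ⟨u, hu, hlu⟩ := extendable_of_getLast hij hc
      (fun y hy => not_mem_eventual_of_ne hij.symm (hlast y hy)) (max m M)
    have huM : ∀ y ∈ x :: (l ++ G), y ≠ u := fun y hy => by have := hM y hy; omega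
    have hux : u ≠ x := (huM x (by simp)).symm
    have hul : u ∉ l := fun h => huM u (by simp [h]) rfl
    have huG : u ∉ G := fun h => huM u (by simp [h]) rfl
    refine ⟨l ++ [u] ++ [x], List.isChain_append.2 ⟨hlu, by simp, ?_⟩, ?_, ?_, ?_, ?_⟩
    · simpa using (hm u (by omega) hux).symm
    · simp only [List.append_assoc, List.nodup_append]
      simp
      grind
    · simp
      grind
    · rintro y (rfl | hy)
      · simp
      · simp [hFl y hy]
    · simpa using hFj (Set.mem_insert x F)

/-- If the finite chains `l₀` and `l₁` can both be continued, then one of them can be continued to a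
chain through a given new number. -/
theorem exists_chain_extension (hij : i ≠ j) {l₀ l₁ : List ℕ} (hn : (l₀ ++ l₁).Nodup)
    (h₀ : l₀.IsChain (Joined c i)) (h₁ : l₁.IsChain (Joined c j))
    (e₀ : Extendable c i l₀) (e₁ : Extendable c j l₁) (x : ℕ) (hx : x ∉ l₀ ++ l₁) :
    ∃ t₀ t₁ : List ℕ, (l₀ ++ t₀).IsChain (Joined c i) ∧ (l₁ ++ t₁).IsChain (Joined c j) ∧
      ((l₀ ++ t₀) ++ (l₁ ++ t₁)).Nodup ∧ x ∈ t₀ ++ t₁ := by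
  obtain ⟨M, hM⟩ := exists_bound (x :: (l₀ ++ l₁))
  obtain ⟨u, hu, hlu⟩ := e₀ M
  obtain ⟨w, hw, hlw⟩ := e₁ (u + 1)
  have hd : ∀ y ∈ x :: (l₀ ++ l₁), y ≠ u ∧ y ≠ w := fun y hy => by have := hM y hy; omega
  have huw : u ≠ w := by omega
  have hxu := (hd x (by simp)).1
  have hxw := (hd x (by simp)).2
  have hu' : u ∉ l₀ ++ l₁ := fun h => (hd u (List.mem_cons_of_mem _ h)).1 rfl
  have hw' : w ∉ l₀ ++ l₁ := fun h => (hd w (List.mem_cons_of_mem _ h)).2 rfl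
  rcases joined_or (c := c) hij hxu.symm with h | h
  · refine ⟨[u, x], [], ?_, by simpa using h₁, ?_, by simp⟩
    · rw [show l₀ ++ [u, x] = l₀ ++ [u] ++ [x] by simp]
      exact List.isChain_append.2 ⟨hlu, by simp, by simpa using h⟩
    · simp only [List.nodup_append] at hn ⊢
      simp at *
      grind
  rcases joined_or (c := c) hij hxw.symm with h' | h'
  swap
  · refine ⟨[], [w, x], by simpa using h₀, ?_, ?_, by simp⟩
    · rw [show l₁ ++ [w, x] = l₁ ++ [w] ++ [x] by simp]
      exact List.isChain_append.2 ⟨hlw, by simp, by simpa using h'⟩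
    · simp only [List.nodup_append] at hn ⊢
      simp at *
      grind
  -- Now `u x` has color `j` and `w x` has color `i`, so whichever color `u w` has, one chain
  -- reaches `x` through both `u` and `w`.
  rcases joined_or (c := c) hij huw with h'' | h''
  · refine ⟨[u, w, x], [], ?_, by simpa using h₁, ?_, by simp⟩
    · rw [show l₀ ++ [u, w, x] = l₀ ++ [u] ++ [w, x] by simp]
      exact List.isChain_append.2 ⟨hlu, by simpa using h', by simpa using h''⟩
    · simp only [List.nodup_append] at hn ⊢
      simp at *
      grind
  · refine ⟨[], [w, u, x], by simpa using h₀, ?_, ?_, by simp⟩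
    · rw [show l₁ ++ [w, u, x] = l₁ ++ [w] ++ [u, x] by simp]
      exact List.isChain_append.2 ⟨hlw, by simpa using h, by simpa using h''.symm⟩
    · simp only [List.nodup_append] at hn ⊢
      simp at *
      grind

/-- If infinitely many numbers have eventual color `j`, and the chains `l₀` and `l₁` can be
continued by all numbers from `n` on, then a new number can be put on one of them so that this
remains true for some other bound. -/
theorem exists_chain_extension_of_infinite (hij : i ≠ j) (hinf : (eventual c j).Infinite)
    {l₀ l₁ : List ℕ} (hn : (l₀ ++ l₁).Nodup) {n : ℕ}
    (h₀ : ∀ u ≥ n, (l₀ ++ [u]).IsChain (Joined c i))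
    (h₁ : ∀ u ≥ n, (l₁ ++ [u]).IsChain (Joined c j)) (x : ℕ) (hx : x ∉ l₀ ++ l₁) :
    ∃ t₀ t₁ : List ℕ, ∃ n' : ℕ, (∀ u ≥ n', (l₀ ++ t₀ ++ [u]).IsChain (Joined c i)) ∧
      (∀ u ≥ n', (l₁ ++ t₁ ++ [u]).IsChain (Joined c j)) ∧
      ((l₀ ++ t₀) ++ (l₁ ++ t₁)).Nodup ∧ x ∈ t₀ ++ t₁ := by
  obtain ⟨M, hM⟩ := exists_bound (x :: n :: (l₀ ++ l₁))
  have hMx := hM x (by simp)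
  have hMn := hM n (by simp)
  by_cases hxi : x ∈ eventual c i
  · obtain ⟨m, hm⟩ := hxi
    have hM' : ∀ y ∈ l₀ ++ l₁, y ≠ max m M := fun y hy => by
      have := hM y (by simp at hy ⊢; tauto)
      omega
    refine ⟨[max m M, x], [], max m M, fun u hu => ?_, fun u hu => ?_, ?_, by simp⟩
    · rw [show l₀ ++ [max m M, x] ++ [u] = l₀ ++ [max m M] ++ [x, u] by simp]
      refine List.isChain_append.2 ⟨h₀ _ (by omega), ?_, ?_⟩
      · simpa using hm u (by omega) (by omega)
      · simpa using (hm _ (by omega) (by omega)).symm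
    · simpa using h₁ u (by omega)
    · simp only [List.nodup_append] at hn ⊢
      simp at *
      grind
  -- The choice `x < a < u < w` gives distinctness. Since `u` and `w` are at least `m`, `a` is
  -- `j`-joined to `w` and to every `v ≥ u`, so `u` serves as the new bound.
  · obtain ⟨a, ⟨m, hm⟩, ha⟩ := hinf.exists_gt M
    obtain ⟨u, hu, hxu⟩ := exists_joined_of_not_mem_eventual hij hxi (max m (a + 1))
    obtain ⟨w, hw, hxw⟩ := exists_joined_of_not_mem_eventual hij hxi (u + 1)
    have hM' : ∀ y ∈ l₀ ++ l₁, y < M := fun y hy => hM y (by simp at hy ⊢; tauto)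
    refine ⟨[], [u, x, w, a], u, fun v hv => ?_, fun v hv => ?_, ?_, by simp⟩
    · simpa using h₀ v (by omega)
    · rw [show l₁ ++ [u, x, w, a] ++ [v] = l₁ ++ [u] ++ [x, w, a, v] by simp]
      refine List.isChain_append.2 ⟨h₁ _ (by omega), ?_, ?_⟩
      · simpa using ⟨hxw, (hm w (by omega) (by omega)).symm, hm v (by omega) (by omega)⟩
      · simpa using hxu.symm
    · simp only [List.nodup_append] at hn ⊢
      simp at *
      grind (splits := 20)

end RadoPath
-- Assembly: limits of lists, the search, and the two cases
namespace RadoPath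

open Encodable

/-! ### Limits of growing lists -/

/-- The partial list that the lists `A 0, A 1, …` converge to if each is a prefix of the next. -/
def limitList (A : ℕ → List ℕ) (n : ℕ) : Part ℕ :=
  (Nat.rfind fun k => Part.some (decide (n < (A k).length))).map fun k => (A k).getD n 0

theorem prefix_of_le {A : ℕ → List ℕ} (hA : ∀ k, A k <+: A (k + 1)) {k l : ℕ} (h : k ≤ l) :
    A k <+: A l := by
  induction h with
  | refl => exact List.prefix_refl _
  | step _ ih => exact ih.trans (hA _)

theorem mem_limitList {A : ℕ → List ℕ} (hA : ∀ k, A k <+: A (k + 1)) {n x : ℕ} :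
    x ∈ limitList A n ↔ ∃ k, (A k)[n]? = some x := by
  constructor
  · intro h
    obtain ⟨k, hk, rfl⟩ := (Part.mem_map_iff _).1 h
    have hk' : n < (A k).length := by simpa using (Nat.mem_rfind.1 hk).1
    exact ⟨k, by simp [hk']⟩
  · rintro ⟨k, hk⟩
    have hk' : n < (A k).length := (List.getElem?_eq_some_iff.1 hk).1
    have hex : ∃ k, n < (A k).length := ⟨k, hk'⟩
    refine (Part.mem_map_iff _).2 ⟨Nat.find hex, Nat.mem_rfind.2 ⟨?_, fun {m} hm => ?_⟩, ?_⟩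
    · simpa using Nat.find_spec hex
    · simpa using Nat.find_min hex hm
    · have hf := Nat.find_spec hex
      have := (prefix_of_le hA (Nat.find_min' hex hk')).getElem hf
      rw [List.getD_eq_getElem _ _ hf, this]
      exact (List.getElem?_eq_some_iff.1 hk).2

theorem mem_limitList_of_le {A : ℕ → List ℕ} (hA : ∀ k, A k <+: A (k + 1)) {n x : ℕ}
    (h : x ∈ limitList A n) : ∃ K, ∀ k ≥ K, (A k)[n]? = some x := by
  obtain ⟨K, hK⟩ := (mem_limitList hA).1 h
  refine ⟨K, fun k hk => ?_⟩
  obtain ⟨h1, h2⟩ := List.getElem?_eq_some_iff.1 hK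
  have hp := prefix_of_le hA hk
  rw [List.getElem?_eq_some_iff]
  exact ⟨h1.trans_le hp.length_le, by rw [← h2, hp.getElem h1]⟩

theorem isPath_limitList {r : ℕ} {c : Coloring r} {j : Fin r} {A : ℕ → List ℕ}
    (hA : ∀ k, A k <+: A (k + 1)) (hn : ∀ k, (A k).Nodup)
    (hc : ∀ k, (A k).IsChain (Joined c j)) : IsPath c j (limitList A) where
  dom_initial m n hmn h := by
    obtain ⟨x, hx⟩ := Part.dom_iff_mem.1 h
    obtain ⟨k, hk⟩ := (mem_limitList hA).1 hx
    have hk' := (List.getElem?_eq_some_iff.1 hk).1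
    exact Part.dom_iff_mem.2 ⟨(A k)[m], (mem_limitList hA).2 ⟨k, by simp⟩⟩
  distinct m n x hm hn' := by
    obtain ⟨K, hK⟩ := mem_limitList_of_le hA hm
    obtain ⟨L, hL⟩ := mem_limitList_of_le hA hn'
    have h1 := hK (max K L) (le_max_left _ _)
    have h2 := hL (max K L) (le_max_right _ _)
    obtain ⟨hm', -⟩ := List.getElem?_eq_some_iff.1 h1
    exact (List.getElem?_inj hm' (hn _)).1 (h1.trans h2.symm)
  color_eq n x y hx hy := by
    obtain ⟨K, hK⟩ := mem_limitList_of_le hA hx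
    obtain ⟨L, hL⟩ := mem_limitList_of_le hA hy
    obtain ⟨_, h1⟩ := List.getElem?_eq_some_iff.1 (hK (max K L) (le_max_left _ _))
    obtain ⟨h3, h2⟩ := List.getElem?_eq_some_iff.1 (hL (max K L) (le_max_right _ _))
    have := List.isChain_iff_getElem.1 (hc (max K L)) n h3
    rwa [h1, h2] at this

/-! ### Searching for a decomposition -/

/-- Two finite lists, and a bound from which on they are required to be extendable. -/
abbrev State : Type := List ℕ × List ℕ × ℕ

/-- The lists of a state are disjoint and without repetitions, and they remain chains of color `i`
and `j` when continued by any of the lists `ext v` with `v` from the bound on. -/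
def Good (c : Coloring 2) (i j : Fin 2) (ext : ℕ → List ℕ) (s : State) : Prop :=
  (s.1 ++ s.2.1).Nodup ∧ ∀ u, (s.1 ++ ext (s.2.2 + u)).IsChain (Joined c i) ∧
    (s.2.1 ++ ext (s.2.2 + u)).IsChain (Joined c j)

/-- The good state `t` extends `s` and covers the number `k`. -/
def Transition (c : Coloring 2) (i j : Fin 2) (ext : ℕ → List ℕ) (k : ℕ) (s t : State) : Prop :=
  (s.1 <+: t.1 ∧ s.2.1 <+: t.2.1) ∧ k ∈ t.1 ++ t.2.1 ∧ Good c i j ext t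

/-- The state with a given code. -/
def State.ofCode (n : ℕ) : State := (decode n : Option State).getD ([], [], 0)

theorem State.ofCode_encode (s : State) : State.ofCode (encode s) = s := by
  rw [State.ofCode, encodek, Option.getD_some]

theorem State.primrec_ofCode : Primrec State.ofCode :=
  Primrec.option_getD.comp Primrec.decode (Primrec.const _)

variable {c : Coloring 2} {i j : Fin 2} {ext : ℕ → List ℕ}

theorem joined_iff_toFun {x y : ℕ} :
    Joined c j x y ↔ x ≠ y ∧ c.toFun (Nat.pair x y) = j := by
  unfold Joined Coloring.toFun
  by_cases h : x = y
  · simp [h]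
  · simp [h, Fin.ext_iff]

theorem isChain_joined_iff {l : List ℕ} :
    l.IsChain (Joined c j) ↔ ∀ m, m + 1 < l.length →
      l.getD m 0 ≠ l.getD (m + 1) 0 ∧ c.toFun (Nat.pair (l.getD m 0) (l.getD (m + 1) 0)) = j := by
  rw [List.isChain_iff_getElem]
  refine forall_congr' fun m => forall_congr' fun h => ?_
  rw [joined_iff_toFun, List.getD_eq_getElem _ _ h, List.getD_eq_getElem _ _ (by omega)]

theorem nodup_iff_getD {l : List ℕ} :
    l.Nodup ↔ ∀ u m, u < m → m < l.length → l.getD u 0 ≠ l.getD m 0 := by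
  rw [List.Nodup, List.pairwise_iff_getElem]
  constructor
  · intro h u m hum hm
    rw [List.getD_eq_getElem _ _ hm, List.getD_eq_getElem _ _ (by omega)]
    exact h u m (by omega) hm hum
  · intro h u m hu hm hum
    rw [← List.getD_eq_getElem _ 0 hm, ← List.getD_eq_getElem _ 0 hu]
    exact h u m hum hm

/-- The list whose edges are inspected by the test with parameters `b` and `u`. -/
def testList (ext : ℕ → List ℕ) (t : State) (b : Bool) (u : ℕ) : List ℕ :=
  (bif b then t.1 else t.2.1) ++ ext (t.2.2 + u)

/-- This is the form required by `DecidesDomains.recursiveIn_forall`: one universal quantifier and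
one value of `c.toFun` per instance. The Boolean selects the chain, `p.2.2` is a position, and
`p.2.1` serves both as offset from the bound and as second position in the test for repetitions. -/
theorem transition_iff {k : ℕ} {s t : State} :
    Transition c i j ext k s t ↔ ∀ p : Bool × ℕ × ℕ,
      ((s.1 = t.1.take s.1.length ∧ s.2.1 = t.2.1.take s.2.1.length) ∧ ∃ a ∈ t.1 ++ t.2.1, a = k) ∧
      ¬ ((p.2.1 < p.2.2 ∧ p.2.2 < (t.1 ++ t.2.1).length) ∧
        (t.1 ++ t.2.1).getD p.2.1 0 = (t.1 ++ t.2.1).getD p.2.2 0) ∧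
      ¬ (p.2.2 + 1 < (testList ext t p.1 p.2.1).length ∧
        ¬ (¬ (testList ext t p.1 p.2.1).getD p.2.2 0 = (testList ext t p.1 p.2.1).getD (p.2.2 + 1) 0 ∧
          c.toFun (Nat.pair ((testList ext t p.1 p.2.1).getD p.2.2 0)
            ((testList ext t p.1 p.2.1).getD (p.2.2 + 1) 0)) =
              bif p.1 then (i : ℕ) else (j : ℕ))) := by
  simp only [Transition, Good, List.prefix_iff_eq_take, nodup_iff_getD, isChain_joined_iff,
    exists_eq_right, Prod.forall, Bool.forall_bool]
  constructor
  · rintro ⟨h1, h2, h3, h4⟩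
    refine ⟨fun u m => ⟨⟨h1, h2⟩, fun h => h3 u m h.1.1 h.1.2 h.2, fun h => h.2 ?_⟩,
      fun u m => ⟨⟨h1, h2⟩, fun h => h3 u m h.1.1 h.1.2 h.2, fun h => h.2 ?_⟩⟩
    · exact (h4 u).2 m h.1
    · exact (h4 u).1 m h.1
  · rintro ⟨hf, ht⟩
    refine ⟨(hf 0 0).1.1, (hf 0 0).1.2, fun u m h h' h'' => (hf u m).2.1 ⟨⟨h, h'⟩, h''⟩,
      fun u => ⟨fun m h => ?_, fun m h => ?_⟩⟩
    · exact by_contra fun h' => (ht u m).2.2 ⟨h, h'⟩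
    · exact by_contra fun h' => (hf u m).2.2 ⟨h, h'⟩

open Classical in
theorem recursiveIn_transition {O : Set (ℕ →. ℕ)} (hO : DecidesDomains O c.toFun)
    (hext : Primrec ext) :
    Nat.RecursiveIn O fun n => Part.some (if Transition c i j ext n.unpair.1.unpair.1
      (State.ofCode n.unpair.1.unpair.2) (State.ofCode n.unpair.2) then 0 else 1) := by
  have hs : Primrec fun a : (ℕ × ℕ) × ℕ => State.ofCode a.1.2 :=
    State.primrec_ofCode.comp (Primrec.snd.comp Primrec.fst)
  have ht : Primrec fun a : (ℕ × ℕ) × ℕ => State.ofCode a.2 :=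
    State.primrec_ofCode.comp Primrec.snd
  have ht₀ := Primrec.fst.comp ht
  have ht₁ := Primrec.fst.comp (Primrec.snd.comp ht)
  have hL : Primrec fun p : ((ℕ × ℕ) × ℕ) × (Bool × ℕ × ℕ) =>
      testList ext (State.ofCode p.1.2) p.2.1 p.2.2.1 :=
    Primrec.list_append.comp
      (Primrec.cond (Primrec.fst.comp Primrec.snd) (ht₀.comp Primrec.fst) (ht₁.comp Primrec.fst))
      (hext.comp (Primrec.nat_add.comp
        (Primrec.snd.comp (Primrec.snd.comp (ht.comp Primrec.fst)))
        (Primrec.fst.comp (Primrec.snd.comp Primrec.snd))))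
  have hu : Primrec fun p : ((ℕ × ℕ) × ℕ) × (Bool × ℕ × ℕ) => p.2.2.1 :=
    Primrec.fst.comp (Primrec.snd.comp Primrec.snd)
  have hm : Primrec fun p : ((ℕ × ℕ) × ℕ) × (Bool × ℕ × ℕ) => p.2.2.2 :=
    Primrec.snd.comp (Primrec.snd.comp Primrec.snd)
  have hm' := Primrec.succ.comp hm
  have hx := (Primrec.list_getD 0).comp hL hm
  have hy := (Primrec.list_getD 0).comp hL hm'
  have happ := Primrec.list_append.comp ht₀ ht₁
  have hs₀ := Primrec.fst.comp hs
  have hs₁ := Primrec.fst.comp (Primrec.snd.comp hs)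
  have hpre : PrimrecPred fun a : (ℕ × ℕ) × ℕ =>
      ((State.ofCode a.1.2).1 = (State.ofCode a.2).1.take (State.ofCode a.1.2).1.length ∧
        (State.ofCode a.1.2).2.1 = (State.ofCode a.2).2.1.take (State.ofCode a.1.2).2.1.length) ∧
      ∃ x ∈ (State.ofCode a.2).1 ++ (State.ofCode a.2).2.1, x = a.1.1 :=
    ((Primrec.eq.comp hs₀ (Primrec.list_take.comp (Primrec.list_length.comp hs₀) ht₀)).and
      (Primrec.eq.comp hs₁ (Primrec.list_take.comp (Primrec.list_length.comp hs₁) ht₁))).and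
      ((PrimrecRel.exists_mem_list Primrec.eq).comp happ (Primrec.fst.comp Primrec.fst))
  have happ' : Primrec fun p : ((ℕ × ℕ) × ℕ) × (Bool × ℕ × ℕ) => _ := happ.comp Primrec.fst
  have hdis := ((Primrec.nat_lt.comp hu hm).and
    (Primrec.nat_lt.comp hm (Primrec.list_length.comp happ'))).and
      (Primrec.eq.comp ((Primrec.list_getD 0).comp happ' hu) ((Primrec.list_getD 0).comp happ' hm))
  have hcol : Primrec fun p : ((ℕ × ℕ) × ℕ) × (Bool × ℕ × ℕ) =>
      bif p.2.1 then (i : ℕ) else (j : ℕ) :=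
    Primrec.cond (Primrec.fst.comp Primrec.snd) (Primrec.const _) (Primrec.const _)
  have hB := (hpre.comp (Primrec.fst.comp Primrec.fst)).and ((hdis.comp Primrec.fst).not.and
    (((Primrec.nat_lt.comp hm' (Primrec.list_length.comp hL)).comp Primrec.fst).and
      (((Primrec.eq.comp hx hy).comp Primrec.fst).not.and
        (Primrec.eq.comp Primrec.snd (hcol.comp Primrec.fst))).not).not)
  refine (hO.recursiveIn_forall (Primrec₂.natPair.comp hx hy) hB).of_eq fun n => ?_
  congr 1
  refine if_congr ?_ rfl rfl
  rw [transition_iff]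
  simp

/-- If every good state above a given one has for every number a good extension covering it, then
there is a path decomposition that is recursive in every set of oracles deciding the domains of the
partial functions recursive in the coloring. -/
theorem exists_decomposition_of_transitions {O : Set (ℕ →. ℕ)} (hO : DecidesDomains O c.toFun)
    (hij : i ≠ j) (hext : Primrec ext) {s₀ : State} (h₀ : Good c i j ext s₀)
    (hstep : ∀ s, Good c i j ext s → s₀.1 <+: s.1 → s₀.2.1 <+: s.2.1 →
      ∀ k, ∃ t, Transition c i j ext k s t) :
    ∃ P : Fin 2 → ℕ →. ℕ, IsPathDecomposition c P ∧ ∀ j, Nat.RecursiveIn O (P j) := by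
  classical
  obtain ⟨S, -, hI, hQ, hS⟩ := exists_recursiveIn_run
    (Q := fun k s t => Transition c i j ext k (State.ofCode s) (State.ofCode t))
    (recursiveIn_transition hO hext)
    (I := fun s => Good c i j ext (State.ofCode s) ∧ s₀.1 <+: (State.ofCode s).1 ∧
      s₀.2.1 <+: (State.ofCode s).2.1) (s₀ := encode s₀)
    (by simpa [State.ofCode_encode] using h₀)
    (fun k s hs => by
      obtain ⟨t, ht⟩ := hstep _ hs.1 hs.2.1 hs.2.2 k
      exact ⟨encode t, by rwa [State.ofCode_encode]⟩)
    (fun k s t hs ht => ⟨ht.2.2, hs.2.1.trans ht.1.1, hs.2.2.trans ht.1.2⟩)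
  let A : ℕ → List ℕ := fun k => (State.ofCode (S k)).1
  let B : ℕ → List ℕ := fun k => (State.ofCode (S k)).2.1
  have hA : ∀ k, A k <+: A (k + 1) := fun k => (hQ k).1.1
  have hB : ∀ k, B k <+: B (k + 1) := fun k => (hQ k).1.2
  have hn : ∀ k, (A k ++ B k).Nodup := fun k => (hI k).1.1
  have hPA : IsPath c i (limitList A) := isPath_limitList hA (fun k => (hn k).of_append_left)
    fun k => ((hI k).1.2 0).1.left_of_append
  have hPB : IsPath c j (limitList B) := isPath_limitList hB (fun k => (hn k).of_append_right)
    fun k => ((hI k).1.2 0).2.left_of_append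
  have hRA : Nat.RecursiveIn O (limitList A) :=
    recursiveIn_read hS (Primrec.fst.comp State.primrec_ofCode)
  have hRB : Nat.RecursiveIn O (limitList B) :=
    recursiveIn_read hS (Primrec.fst.comp (Primrec.snd.comp State.primrec_ofCode))
  have hcases : ∀ k, k = i ∨ k = j := fun k => by omega
  have hcover : ∀ x, (∃ n, x ∈ limitList A n) ∨ ∃ n, x ∈ limitList B n := by
    intro x
    rcases List.mem_append.1 (hQ x).2.1 with h | h
    · obtain ⟨n, hn⟩ := List.mem_iff_getElem?.1 h
      -- The transition at stage `x` covers `x` in the state with index `x + 1`.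
      exact Or.inl ⟨n, (mem_limitList hA).2 ⟨x + 1, hn⟩⟩
    · obtain ⟨n, hn⟩ := List.mem_iff_getElem?.1 h
      exact Or.inr ⟨n, (mem_limitList hB).2 ⟨x + 1, hn⟩⟩
  have hdisj : ∀ x, ¬ ((∃ n, x ∈ limitList A n) ∧ ∃ n, x ∈ limitList B n) := by
    rintro x ⟨⟨m, hm⟩, n, hn'⟩
    obtain ⟨K, hK⟩ := mem_limitList_of_le hA hm
    obtain ⟨L, hL⟩ := mem_limitList_of_le hB hn'
    exact (List.disjoint_of_nodup_append (hn (max K L)))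
      (List.mem_of_getElem? (hK _ (le_max_left _ _))) (List.mem_of_getElem? (hL _ (le_max_right _ _)))
  refine ⟨fun k => if k = i then limitList A else limitList B, ⟨fun k => ?_, fun x => ?_⟩,
    fun k => ?_⟩
  · rcases hcases k with rfl | rfl
    · simpa using hPA
    · simpa [hij.symm] using hPB
  · rcases hcover x with h | h
    · refine ⟨i, by simpa using h, fun k hk => ?_⟩
      by_contra hki
      exact hdisj x ⟨h, by simpa [hki] using hk⟩
    · refine ⟨j, by simpa [hij.symm] using h, fun k hk => ?_⟩
      rcases hcases k with rfl | rfl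
      · exact absurd ⟨by simpa using hk, h⟩ (hdisj x)
      · rfl
  · by_cases hk : k = i
    · simpa [hk] using hRA
    · simpa [hk] using hRB

/-- Taking `ext u = [u]` makes every number from the bound on a legal continuation of both chains.
The search tests only this and never has to recognize eventual colors. -/
theorem exists_decomposition_of_infinite {O : Set (ℕ →. ℕ)} (hO : DecidesDomains O c.toFun)
    (hij : i ≠ j) (hinf : (eventual c j).Infinite) :
    ∃ P : Fin 2 → ℕ →. ℕ, IsPathDecomposition c P ∧ ∀ j, Nat.RecursiveIn O (P j) := by
  refine exists_decomposition_of_transitions hO hij (ext := fun u => [u])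
    (Primrec.list_cons.comp Primrec.id (Primrec.const [])) (s₀ := ([], [], 0)) (by simp [Good])
    fun s hs _ _ k => ?_
  by_cases hk : k ∈ s.1 ++ s.2.1
  · exact ⟨s, ⟨List.prefix_refl _, List.prefix_refl _⟩, hk, hs⟩
  have h : ∀ u ≥ s.2.2, (s.1 ++ [u]).IsChain (Joined c i) ∧
      (s.2.1 ++ [u]).IsChain (Joined c j) := fun u hu => by
    simpa only [Nat.add_sub_cancel' hu] using hs.2 (u - s.2.2)
  obtain ⟨t₀, t₁, n, h0, h1, hn, hkt⟩ := exists_chain_extension_of_infinite hij hinf hs.1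
    (fun u hu => (h u hu).1) (fun u hu => (h u hu).2) k hk
  refine ⟨(s.1 ++ t₀, s.2.1 ++ t₁, n), ⟨List.prefix_append _ _, List.prefix_append _ _⟩, ?_, hn,
    fun u => ⟨h0 _ (Nat.le_add_right _ _), h1 _ (Nat.le_add_right _ _)⟩⟩
  simp only [List.mem_append] at hkt ⊢
  tauto

/-- With `ext` empty, goodness constrains only the finite chains themselves. Extendability comes
from the initial state, which is finite information and need not be computed. -/
theorem exists_decomposition_of_finite {O : Set (ℕ →. ℕ)} (hO : DecidesDomains O c.toFun)
    (hij : i ≠ j) (hi : (eventual c i).Finite) (hj : (eventual c j).Finite) :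
    ∃ P : Fin 2 → ℕ →. ℕ, IsPathDecomposition c P ∧ ∀ j, Nat.RecursiveIn O (P j) := by
  -- `a` avoids `eventual c j`, so that `b` can contain that set and still be disjoint from `a`.
  obtain ⟨a, hac, han, haG, haF, hal⟩ := exists_chain_superset hij.symm hi subset_rfl
    hj.toFinset.toList (fun x hx h => not_mem_eventual_of_ne hij hx (by simpa using h))
  obtain ⟨b, hbc, hbn, hbG, hbF, hbl⟩ := exists_chain_superset hij hj subset_rfl a
    (fun x hx h => haG x h (by simpa using hx))
  have hab : (a ++ b).Nodup := List.nodup_append'.2 ⟨han, hbn, fun x h h' => hbG x h' h⟩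
  refine exists_decomposition_of_transitions hO hij (ext := fun _ => [])
    (Primrec.const []) (s₀ := (a, b, 0)) ⟨hab, by simp [hac, hbc]⟩
    fun s hs hsa hsb k => ?_
  by_cases hk : k ∈ s.1 ++ s.2.1
  · exact ⟨s, ⟨List.prefix_refl _, List.prefix_refl _⟩, hk, hs⟩
  obtain ⟨l₀, l₁, n⟩ := s
  obtain ⟨a', rfl⟩ := hsa
  obtain ⟨b', rfl⟩ := hsb
  obtain ⟨hn, hc⟩ := hs
  have hc0 : (a ++ a').IsChain (Joined c i) := by simpa using (hc 0).1
  have hc1 : (b ++ b').IsChain (Joined c j) := by simpa using (hc 0).2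
  have e0 : Extendable c i (a ++ a') := by
    -- The last element either ends `a`, and then has eventual color `i`, or was added later, and
    -- then is not in `b`, which contains all of `eventual c j`.
    refine extendable_of_getLast hij.symm hc0 fun x hx hxj => ?_
    rcases List.eq_nil_or_concat a' with rfl | ⟨a'', y, rfl⟩
    · exact not_mem_eventual_of_ne hij (hal x (by simpa using hx)) hxj
    · obtain rfl : y = x := by simpa [← List.append_assoc] using hx
      exact List.disjoint_of_nodup_append hn (a := y) (by simp)
        (List.mem_append_left _ (hbF y hxj))
  have e1 : Extendable c j (b ++ b') := by
    refine extendable_of_getLast hij hc1 fun x hx hxi => ?_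
    rcases List.eq_nil_or_concat b' with rfl | ⟨b'', y, rfl⟩
    · exact not_mem_eventual_of_ne hij hxi (hbl x (by simpa using hx))
    · obtain rfl : y = x := by simpa [← List.append_assoc] using hx
      exact List.disjoint_of_nodup_append hn (a := y) (List.mem_append_left _ (haF y hxi))
        (by simp)
  obtain ⟨t₀, t₁, h0, h1, hn', hkt⟩ := exists_chain_extension hij hn hc0 hc1 e0 e1 k hk
  refine ⟨(a ++ a' ++ t₀, b ++ b' ++ t₁, n), ⟨List.prefix_append _ _, List.prefix_append _ _⟩, ?_,
    hn', fun u => ⟨by simpa using h0, by simpa using h1⟩⟩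
  simp only [List.mem_append] at hkt ⊢
  tauto

theorem exists_decomposition {O : Set (ℕ →. ℕ)} (c : Coloring 2)
    (hO : DecidesDomains O c.toFun) :
    ∃ P : Fin 2 → ℕ →. ℕ, IsPathDecomposition c P ∧ ∀ j, Nat.RecursiveIn O (P j) := by
  by_cases h0 : (eventual c 0).Finite
  · by_cases h1 : (eventual c 1).Finite
    · exact exists_decomposition_of_finite hO zero_ne_one h0 h1
    · exact exists_decomposition_of_infinite hO zero_ne_one h1
  -- The colors swap roles here: `i = 1` and `j = 0`.
  · exact exists_decomposition_of_infinite hO one_ne_zero h0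

end RadoPath

theorem theorem4p2 :
    (∀ c : RadoPath.Coloring 2, ∃ P : Fin 2 → ℕ →. ℕ,
      RadoPath.IsPathDecomposition c P ∧ RadoPath.IsDelta2In c P) ∧
    (∀ c : RadoPath.Coloring 2, c.IsComputable → ∃ P : Fin 2 → ℕ →. ℕ,
      RadoPath.IsPathDecomposition c P ∧
        ∀ j : Fin 2, RadoPath.ComputableFrom RadoPath.haltingSet (P j)) :=
  ⟨fun c => RadoPath.exists_decomposition c (RadoPath.decidesDomains_jump _),
    fun c hc => RadoPath.exists_decomposition c (RadoPath.decidesDomains_haltingSet hc)⟩
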